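/- Let $\alpha>2$ and $\lambda_1,\lambda_2>0$, and let $\Phi_1,\Phi_2$ be independent homogeneous Poisson point processes in the plane $\mathbb{R}^2$ with densities (mean numbers of points per unit area) $\lambda_1$ and $\lambda_2$, respectively. Put $S(\Phi_i)=\sum_{X\in\Phi_i}|X|^{-\alpha}$ for $i=1,2$ (shot noise without fading), where $|X|$ is the distance of $X$ from the origin. Then almost surely $0<S(\Phi_1)<\infty$ and $0<S(\Phi_2)<\infty$, so that the shot-noise ratio $R=S(\Phi_1)/S(\Phi_2)$ is almost surely a well-defined positive real number, and for every real $x\ge 0$ $$\Pr(R>x)=\frac12+\frac{\alpha}{2\pi}\arctan\left(\left(-1+\frac{2}{1+\frac{\lambda_2}{\lambda_1}x^{2/\alpha}}\right)\tan\frac{\pi}{\alpha}\right).$$ -/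

import Mathlib

open MeasureTheory ProbabilityTheory
open scoped NNReal ENNReal

noncomputable section

/-- The Euclidean plane. -/
abbrev Plane : Type := EuclideanSpace ℝ (Fin 2)

/-- A point configuration: a locally finite set of points of the plane. -/
structure Configuration where
  /-- the points of the configuration -/
  points : Set Plane
  locallyFinite : ∀ B : Set Plane, Bornology.IsBounded B → (points ∩ B).Finite

/-- The number of points of a configuration in a set. -/
def Configuration.count (A : Set Plane) (φ : Configuration) : ℕ∞ :=
  (φ.points ∩ A).encard

/-- The usual σ-algebra on configurations: the smallest one for which the number of points in
each Borel set is measurable. -/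
instance Configuration.instMeasurableSpace : MeasurableSpace Configuration :=
  ⨆ A : {A : Set Plane // MeasurableSet A},
    MeasurableSpace.comap (Configuration.count (A : Set Plane)) inferInstance

/-- `Φ` is a homogeneous Poisson point process in the plane with density `lam`: the number of
points in a bounded Borel set `A` is Poisson distributed with mean `lam * |A|`, and the numbers
of points in finitely many pairwise disjoint bounded Borel sets are independent. -/
structure IsHomogeneousPPP {Ω : Type*} [MeasurableSpace Ω] (Φ : Ω → Configuration) (lam : ℝ≥0)
    (μ : Measure Ω) : Prop where
  measurable : Measurable Φ
  map_count : ∀ A : Set Plane, MeasurableSet A → Bornology.IsBounded A →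
    μ.map (fun ω => (Φ ω).count A) =
      (poissonMeasure (lam * (volume A).toNNReal)).map (Nat.cast : ℕ → ℕ∞)
  iIndepFun_count : ∀ (n : ℕ) (A : Fin n → Set Plane), (∀ i, MeasurableSet (A i)) →
    (∀ i, Bornology.IsBounded (A i)) → Pairwise (fun i j => Disjoint (A i) (A j)) →
    iIndepFun (fun i ω => (Φ ω).count (A i)) μ

/-- The shot noise without fading `∑_{X ∈ φ} |X|^(-α)`, as a sum in `[0, ∞]`
(a point at the origin contributes `∞`). -/
def shotNoise (α : ℝ) (φ : Configuration) : ℝ≥0∞ :=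
  ∑' X : φ.points, ‖(X : Plane)‖ₑ ^ (-α)

/-- The shot-noise ratio of two configurations. -/
def shotNoiseRatio (α : ℝ) (φ₁ φ₂ : Configuration) : ℝ≥0∞ :=
  shotNoise α φ₁ / shotNoise α φ₂

end

/-!
Write `δ = 2 / α`. The Laplace functional of a Poisson point process
(`IsHomogeneousPPP.lintegral_expNeg`) and a dilation of the plane show that the shot noise of a
process of density `λ` is positive stable: `E[e^{-sS}] = exp (-λ C s ^ δ)`, where `C ∈ (0, ∞)`
depends only on `α` (`IsHomogeneousPPP.lintegral_expNeg_shotNoise`). Letting `s → 0` and `s → ∞`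
gives `0 < S < ∞` almost surely (`ae_mem_Ioo_of_laplace`).

For `x > 0` the event `R > x` is, almost surely, the event `S₁ - x S₂ > 0`. With `a = λ₁ C` and
`b = λ₂ C x ^ δ`, analytic continuation of the Laplace transforms to the imaginary axis gives
`S₁ - x S₂` the characteristic function `φ(t) = exp (-A t ^ δ + i B t ^ δ)` for `t > 0`, where
`A = (a + b) cos (π / α)` and `B = (a - b) sin (π / α)` (`integral_cexp_sub`). The Gil-Pelaez
formula (`measureReal_pos_eq_of_integrableOn`) gives
`P(R > x) = 1 / 2 + (1 / π) ∫₀^∞ Im φ(t) / t dt`, and the substitution `u = t ^ δ` turns the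
integral into `(1 / δ) ∫₀^∞ e^{-Au} sin (Bu) / u du = (1 / δ) arctan (B / A)`. Only the ratio
`b / a` enters, so the value of `C` is not needed.
-/

open Filter Topology

/-! ### The function `e^{-x}` on `[0, ∞]` -/

/-- The function `e^{-x}` on `[0, ∞]`, with `e^{-∞} = 0`. Keeping the extended argument lets the
Laplace transform of a shot noise be computed before the shot noise is known to be finite. -/
noncomputable def expNeg (x : ℝ≥0∞) : ℝ≥0∞ := EReal.exp (-(x : EReal))

@[simp] lemma expNeg_zero : expNeg 0 = 1 := by simp [expNeg]

@[simp] lemma expNeg_top : expNeg ∞ = 0 := by simp [expNeg]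

lemma expNeg_coe (x : ℝ≥0) : expNeg x = ENNReal.ofReal (Real.exp (-x)) := by
  rw [← EReal.exp_coe]; rfl

lemma expNeg_ofReal {x : ℝ} (hx : 0 ≤ x) :
    expNeg (ENNReal.ofReal x) = ENNReal.ofReal (Real.exp (-x)) := by
  rw [ENNReal.ofReal, expNeg_coe, Real.coe_toNNReal x hx]

lemma expNeg_le_one (x : ℝ≥0∞) : expNeg x ≤ 1 := by
  simp [expNeg, EReal.coe_ennreal_nonneg]

lemma expNeg_ne_top (x : ℝ≥0∞) : expNeg x ≠ ∞ :=
  ((expNeg_le_one x).trans_lt ENNReal.one_lt_top).ne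

lemma expNeg_antitone : Antitone expNeg := fun x y h ↦ by
  simpa [expNeg] using h

lemma continuous_expNeg : Continuous expNeg :=
  ENNReal.continuous_exp.comp (continuous_neg.comp continuous_coe_ennreal_ereal)

lemma measurable_expNeg : Measurable expNeg := continuous_expNeg.measurable

lemma expNeg_add (x y : ℝ≥0∞) : expNeg (x + y) = expNeg x * expNeg y := by
  rw [expNeg, EReal.coe_ennreal_add, EReal.neg_add (by simp) (by simp), sub_eq_add_neg,
    EReal.exp_add]
  rfl

lemma expNeg_sum {ι : Type*} (s : Finset ι) (f : ι → ℝ≥0∞) :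
    expNeg (∑ i ∈ s, f i) = ∏ i ∈ s, expNeg (f i) := by
  classical
  induction s using Finset.induction_on with
  | empty => simp
  | insert i s hi ih => rw [Finset.sum_insert hi, Finset.prod_insert hi, expNeg_add, ih]

lemma expNeg_mul_natCast (x : ℝ≥0∞) (n : ℕ) : expNeg (x * n) = expNeg x ^ n := by
  induction n with
  | zero => simp
  | succ n ih => rw [Nat.cast_succ, mul_add, expNeg_add, ih, mul_one, pow_succ]

lemma toReal_expNeg {x : ℝ≥0∞} (hx : x ≠ ∞) : (expNeg x).toReal = Real.exp (-x.toReal) := by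
  lift x to ℝ≥0 using hx
  rw [expNeg_coe, ENNReal.toReal_ofReal (Real.exp_nonneg _)]; rfl

/-! ### The Laplace functional of a Poisson point process -/

lemma lintegral_pow_poissonMeasure (m : ℝ≥0) (c : ℝ≥0∞) :
    ∫⁻ n : ℕ, expNeg c ^ n ∂(poissonMeasure m) = expNeg (m * (1 - expNeg c)) := by
  obtain ⟨z, hz⟩ : ∃ z : ℝ≥0, (z : ℝ≥0∞) = expNeg c :=
    ⟨_, ENNReal.coe_toNNReal (expNeg_ne_top c)⟩
  have hz1 : z ≤ 1 := by
    have := expNeg_le_one c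
    rw [← hz] at this
    exact_mod_cast this
  have key : HasSum (fun n : ℕ ↦ Real.exp (-m) * m ^ n / n.factorial * (z : ℝ) ^ n)
      (Real.exp (-(m * (1 - z) : ℝ≥0))) := by
    have h := (NormedSpace.expSeries_div_hasSum_exp ((m : ℝ) * z)).mul_left (Real.exp (-m))
    rw [← Real.exp_eq_exp_ℝ, ← Real.exp_add] at h
    have hexp : -((m * (1 - z) : ℝ≥0) : ℝ) = -m + m * z := by
      rw [NNReal.coe_mul, NNReal.coe_sub hz1, NNReal.coe_one]; ring
    have hterm : (fun n : ℕ ↦ Real.exp (-m) * m ^ n / n.factorial * (z : ℝ) ^ n) =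
        fun n : ℕ ↦ Real.exp (-m) * (((m : ℝ) * z) ^ n / n.factorial) := by
      ext n; rw [mul_pow]; ring
    rw [hexp, hterm]
    exact h
  rw [← hz, poissonMeasure, lintegral_sum_measure]
  have : (m : ℝ≥0∞) * (1 - z) = ((m * (1 - z) : ℝ≥0) : ℝ≥0∞) := by push_cast; rfl
  rw [this, expNeg_coe, ← key.tsum_eq, ENNReal.ofReal_tsum_of_nonneg _ key.summable]
  · refine tsum_congr fun n ↦ ?_
    rw [lintegral_smul_measure, lintegral_dirac, smul_eq_mul, ENNReal.ofReal_mul (by positivity)]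
    congr 1
    rw [← NNReal.coe_pow, ENNReal.ofReal_coe_nnreal, ENNReal.coe_pow]
  · intro n; positivity

/-- The counting measure of a configuration. -/
noncomputable def Configuration.toMeasure (φ : Configuration) : Measure Plane :=
  Measure.sum fun X : φ.points ↦ Measure.dirac (X : Plane)

lemma Configuration.toMeasure_apply (φ : Configuration) {A : Set Plane} (hA : MeasurableSet A) :
    φ.toMeasure A = (φ.count A : ℝ≥0∞) := by
  rw [toMeasure, Measure.sum_apply _ hA, count, ← ENNReal.tsum_set_one]
  simp only [Measure.dirac_apply' _ hA]
  rw [tsum_subtype φ.points (A.indicator 1), tsum_subtype (φ.points ∩ A) fun _ ↦ 1,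
    Set.indicator_indicator]
  rfl

lemma Configuration.lintegral_toMeasure (φ : Configuration) (f : Plane → ℝ≥0∞) :
    ∫⁻ x, f x ∂φ.toMeasure = ∑' X : φ.points, f X := by
  simp [toMeasure, lintegral_sum_measure]

lemma Configuration.measurable_count {A : Set Plane} (hA : MeasurableSet A) :
    Measurable (Configuration.count A) :=
  Measurable.of_comap_le (le_iSup (fun A : {A : Set Plane // MeasurableSet A} ↦
    MeasurableSpace.comap (Configuration.count (A : Set Plane)) inferInstance) ⟨A, hA⟩)

lemma Configuration.measurable_toMeasure : Measurable Configuration.toMeasure := by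
  refine Measure.measurable_of_measurable_coe _ fun A hA ↦ ?_
  simp only [toMeasure_apply _ hA]
  exact (Measurable.of_discrete (f := fun n : ℕ∞ ↦ (n : ℝ≥0∞))).comp (measurable_count hA)

lemma Configuration.measurable_lintegral {f : Plane → ℝ≥0∞} (hf : Measurable f) :
    Measurable fun φ : Configuration ↦ ∫⁻ x, f x ∂φ.toMeasure :=
  (Measure.measurable_lintegral hf).comp measurable_toMeasure

section LaplaceFunctional

variable {Ω : Type*} [MeasurableSpace Ω] {μ : Measure Ω} {Φ : Ω → Configuration} {lam : ℝ≥0}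

lemma IsHomogeneousPPP.lintegral_expNeg_count (hΦ : IsHomogeneousPPP Φ lam μ) {A : Set Plane}
    (hA : MeasurableSet A) (hAb : Bornology.IsBounded A) (c : ℝ≥0∞) :
    ∫⁻ ω, expNeg (c * (Φ ω).toMeasure A) ∂μ = expNeg (lam * (volume A * (1 - expNeg c))) := by
  have h1 : ∫⁻ ω, expNeg (c * (Φ ω).toMeasure A) ∂μ =
      ∫⁻ n : ℕ∞, expNeg (c * (n : ℝ≥0∞)) ∂(μ.map fun ω ↦ (Φ ω).count A) := by
    rw [lintegral_map Measurable.of_discrete (show Measurable fun ω ↦ (Φ ω).count A from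
      (Configuration.measurable_count hA).comp hΦ.measurable)]
    simp only [Configuration.toMeasure_apply _ hA]
  rw [h1, hΦ.map_count A hA hAb, lintegral_map Measurable.of_discrete Measurable.of_discrete]
  simp only [ENat.toENNReal_coe, expNeg_mul_natCast]
  rw [lintegral_pow_poissonMeasure, ENNReal.coe_mul,
    ENNReal.coe_toNNReal hAb.measure_lt_top.ne, mul_assoc]

/-- The Laplace functional on simple functions cut off to a bounded set: the integral against the
point process is a combination of the counts in the disjoint level sets. -/
lemma IsHomogeneousPPP.lintegral_expNeg_simpleFunc (hΦ : IsHomogeneousPPP Φ lam μ)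
    (g : SimpleFunc Plane ℝ≥0∞) {B : Set Plane} (hB : MeasurableSet B)
    (hBb : Bornology.IsBounded B) :
    ∫⁻ ω, expNeg (∫⁻ x, B.indicator g x ∂(Φ ω).toMeasure) ∂μ =
      expNeg (lam * ∫⁻ x, (1 - expNeg (B.indicator g x))) := by
  have hlevel (c : ℝ≥0∞) : MeasurableSet (g ⁻¹' {c} ∩ B) := (g.measurableSet_fiber c).inter hB
  have hint (h : ℝ≥0∞ → ℝ≥0∞) (ν : Measure Plane) :
      ∫⁻ x in B, h (g x) ∂ν = ∑ c ∈ g.range, h c * ν (g ⁻¹' {c} ∩ B) := by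
    have : ∫⁻ x in B, h (g x) ∂ν = ∫⁻ x in B, (g.map h) x ∂ν := rfl
    rw [this, SimpleFunc.lintegral_eq_lintegral, SimpleFunc.map_lintegral]
    exact Finset.sum_congr rfl fun c _ ↦ by rw [Measure.restrict_apply (g.measurableSet_fiber c)]
  have hL (ω : Ω) : ∫⁻ x, B.indicator g x ∂(Φ ω).toMeasure =
      ∑ c ∈ g.range, c * (Φ ω).toMeasure (g ⁻¹' {c} ∩ B) := by
    rw [lintegral_indicator hB]
    exact hint id _
  have hR : ∫⁻ x, (1 - expNeg (B.indicator g x)) =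
      ∑ c ∈ g.range, volume (g ⁻¹' {c} ∩ B) * (1 - expNeg c) := by
    have : (fun x ↦ 1 - expNeg (B.indicator g x)) =
        B.indicator fun x ↦ 1 - expNeg (g x) := by
      ext x; by_cases hx : x ∈ B <;> simp [hx]
    rw [this, lintegral_indicator hB, hint (fun c ↦ 1 - expNeg c)]
    exact Finset.sum_congr rfl fun c _ ↦ mul_comm _ _
  simp only [hL, hR, expNeg_sum, Finset.mul_sum]
  let e := g.range.equivFin
  let A : Fin g.range.card → Set Plane := fun i ↦ g ⁻¹' {(e.symm i : ℝ≥0∞)} ∩ B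
  have hindep := hΦ.iIndepFun_count _ A (fun i ↦ hlevel _)
    (fun i ↦ hBb.subset Set.inter_subset_right) (fun i j hij ↦ by
      refine Set.disjoint_left.mpr fun x hx hx' ↦ hij ?_
      have h1 : g x = e.symm i := hx.1
      have h2 : g x = e.symm j := hx'.1
      exact e.symm.injective (Subtype.ext (h1.symm.trans h2)))
  have hcomp := hindep.comp
    (fun i (n : ℕ∞) ↦ expNeg ((e.symm i : ℝ≥0∞) * (n : ℝ≥0∞))) fun i ↦ Measurable.of_discrete
  have hprod := lintegral_prod_eq_prod_lintegral_of_indepFun Finset.univ _ hcomp fun i ↦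
    Measurable.of_discrete.comp ((Configuration.measurable_count (hlevel _)).comp hΦ.measurable)
  have hreindex (F : ℝ≥0∞ → ℝ≥0∞) : ∏ c ∈ g.range, F c = ∏ i, F (e.symm i) := by
    rw [← Finset.prod_coe_sort, ← e.symm.prod_comp]
  simp only [hreindex]
  refine Eq.trans ?_ (hprod.trans (Finset.prod_congr rfl fun i _ ↦ ?_))
  · simp only [Function.comp, A, Configuration.toMeasure_apply _ (hlevel _)]
  · rw [← hΦ.lintegral_expNeg_count (hlevel _) (hBb.subset Set.inter_subset_right)]
    simp only [Function.comp, A, Configuration.toMeasure_apply _ (hlevel _)]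

lemma tendsto_lintegral_expNeg [IsProbabilityMeasure μ] {F : ℕ → Ω → ℝ≥0∞} {f : Ω → ℝ≥0∞}
    (hF : ∀ n, Measurable (F n)) (h : ∀ ω, Tendsto (fun n ↦ F n ω) atTop (𝓝 (f ω))) :
    Tendsto (fun n ↦ ∫⁻ ω, expNeg (F n ω) ∂μ) atTop (𝓝 (∫⁻ ω, expNeg (f ω) ∂μ)) :=
  tendsto_lintegral_of_dominated_convergence (fun _ ↦ 1)
    (fun n ↦ measurable_expNeg.comp (hF n)) (fun n ↦ ae_of_all _ fun ω ↦ expNeg_le_one _)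
    (by simp) (ae_of_all _ fun ω ↦ (continuous_expNeg.tendsto _).comp (h ω))

/-- **Laplace functional** of a homogeneous Poisson point process. -/
theorem IsHomogeneousPPP.lintegral_expNeg [IsProbabilityMeasure μ]
    (hΦ : IsHomogeneousPPP Φ lam μ) {f : Plane → ℝ≥0∞} (hf : Measurable f) :
    ∫⁻ ω, expNeg (∫⁻ x, f x ∂(Φ ω).toMeasure) ∂μ = expNeg (lam * ∫⁻ x, (1 - expNeg (f x))) := by
  let B (n : ℕ) : Set Plane := Metric.closedBall 0 n
  have hB (n : ℕ) : MeasurableSet (B n) := measurableSet_closedBall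
  let F (n : ℕ) : Plane → ℝ≥0∞ := (B n).indicator (SimpleFunc.eapprox f n)
  have hF (n : ℕ) : Measurable (F n) := (SimpleFunc.measurable _).indicator (hB n)
  have hmono : Monotone F := fun m n hmn x ↦ by
    refine (Set.indicator_le_indicator (SimpleFunc.monotone_eapprox f hmn x)).trans ?_
    exact Set.indicator_le_indicator_of_subset
      (Metric.closedBall_subset_closedBall (by exact_mod_cast hmn)) (fun _ ↦ zero_le) x
  have hlim (x : Plane) : Tendsto (fun n ↦ F n x) atTop (𝓝 (f x)) := by
    refine (SimpleFunc.tendsto_eapprox hf x).congr' ?_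
    filter_upwards [eventually_ge_atTop ⌈‖x‖⌉₊] with n hn
    refine (Set.indicator_of_mem (s := B n) ?_ (SimpleFunc.eapprox f n)).symm
    simpa [B] using Nat.ceil_le.mp hn
  have hleft := tendsto_lintegral_expNeg (μ := μ)
    (F := fun n ω ↦ ∫⁻ x, F n x ∂(Φ ω).toMeasure)
    (fun n ↦ (Configuration.measurable_lintegral (hF n)).comp hΦ.measurable)
    (fun ω ↦ lintegral_tendsto_of_tendsto_of_monotone (fun n ↦ (hF n).aemeasurable)
      (ae_of_all _ fun x m n hmn ↦ hmono hmn x) (ae_of_all _ hlim))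
  have hright : Tendsto (fun n ↦ ∫⁻ x, (1 - expNeg (F n x))) atTop
      (𝓝 (∫⁻ x, (1 - expNeg (f x)))) := by
    refine lintegral_tendsto_of_tendsto_of_monotone
      (fun n ↦ (measurable_const.sub (measurable_expNeg.comp (hF n))).aemeasurable)
      (ae_of_all _ fun x m n hmn ↦ tsub_le_tsub_left (expNeg_antitone (hmono hmn x)) 1)
      (ae_of_all _ fun x ↦ ?_)
    exact ENNReal.Tendsto.sub tendsto_const_nhds ((continuous_expNeg.tendsto _).comp (hlim x))
      (Or.inl ENNReal.one_ne_top)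
  have hright' := (continuous_expNeg.tendsto _).comp
    (ENNReal.Tendsto.const_mul (a := (lam : ℝ≥0∞)) hright (Or.inr ENNReal.coe_ne_top))
  refine tendsto_nhds_unique hleft (hright'.congr fun n ↦ ?_)
  exact (hΦ.lintegral_expNeg_simpleFunc _ (hB n) Metric.isBounded_closedBall).symm

end LaplaceFunctional

/-! ### The Laplace transform of the shot noise -/

lemma measurable_enorm_rpow (α : ℝ) : Measurable fun x : Plane ↦ ‖x‖ₑ ^ (-α) :=
  measurable_enorm.pow_const _

lemma shotNoise_eq_lintegral (α : ℝ) (φ : Configuration) :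
    shotNoise α φ = ∫⁻ x, ‖x‖ₑ ^ (-α) ∂φ.toMeasure :=
  (φ.lintegral_toMeasure fun x ↦ ‖x‖ₑ ^ (-α)).symm

lemma measurable_shotNoise (α : ℝ) : Measurable (shotNoise α) := by
  simp only [funext (shotNoise_eq_lintegral α)]
  exact Configuration.measurable_lintegral (measurable_enorm_rpow α)

/-- The constant in the Laplace exponent of the shot noise: the exponent at `s = 1` for unit
density. Its value is immaterial, since only the ratio of two Laplace exponents matters. -/
noncomputable def shotNoiseConst (α : ℝ) : ℝ≥0∞ := ∫⁻ x : Plane, (1 - expNeg (‖x‖ₑ ^ (-α)))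

/-- The dilation `x ↦ s ^ (-1/α) • x` of the plane absorbs the factor `s`. -/
lemma lintegral_one_sub_expNeg_mul {α : ℝ} (hα : 0 < α) {s : ℝ} (hs : 0 < s) :
    ∫⁻ x : Plane, (1 - expNeg (ENNReal.ofReal s * ‖x‖ₑ ^ (-α))) =
      ENNReal.ofReal (s ^ (2 / α)) * shotNoiseConst α := by
  set r : ℝ := s ^ (-(1 / α)) with hr
  have hr0 : 0 < r := Real.rpow_pos_of_pos hs _
  have hrs : r ^ (-α) = s := by
    rw [hr, ← Real.rpow_mul hs.le, neg_mul_neg, one_div_mul_cancel hα.ne', Real.rpow_one]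
  have hr2 : |(r ^ Module.finrank ℝ Plane)⁻¹| = s ^ (2 / α) := by
    rw [abs_of_pos (by positivity), finrank_euclideanSpace_fin, hr, ← Real.rpow_natCast,
      ← Real.rpow_mul hs.le, ← Real.rpow_neg hs.le]
    congr 1
    push_cast
    ring
  have hmeas : Measurable fun x : Plane ↦ 1 - expNeg (‖x‖ₑ ^ (-α)) :=
    measurable_const.sub (measurable_expNeg.comp (measurable_enorm_rpow α))
  calc ∫⁻ x : Plane, (1 - expNeg (ENNReal.ofReal s * ‖x‖ₑ ^ (-α)))
      = ∫⁻ x : Plane, (1 - expNeg (‖r • x‖ₑ ^ (-α))) := by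
        refine lintegral_congr fun x ↦ ?_
        rw [enorm_smul, ENNReal.mul_rpow_of_ne_top enorm_ne_top enorm_ne_top,
          Real.enorm_of_nonneg hr0.le, ENNReal.ofReal_rpow_of_pos hr0, hrs]
    _ = ∫⁻ x, (1 - expNeg (‖x‖ₑ ^ (-α))) ∂(Measure.map (r • ·) (volume : Measure Plane)) :=
        (lintegral_map hmeas (measurable_const_smul r)).symm
    _ = _ := by
        rw [Measure.map_addHaar_smul _ hr0.ne', lintegral_smul_measure, hr2, smul_eq_mul]
        rfl

lemma shotNoiseConst_ne_zero {α : ℝ} (hα : 0 < α) : shotNoiseConst α ≠ 0 := by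
  have hmeas : Measurable fun x : Plane ↦ 1 - expNeg (‖x‖ₑ ^ (-α)) :=
    measurable_const.sub (measurable_expNeg.comp (measurable_enorm_rpow α))
  rw [shotNoiseConst, ne_eq, lintegral_eq_zero_iff hmeas]
  intro h
  obtain ⟨x, hx⟩ := h.exists
  have h1 : (1 : ℝ≥0∞) ≤ expNeg (‖x‖ₑ ^ (-α)) := tsub_eq_zero_iff_le.mp hx
  have h2 : ‖x‖ₑ ^ (-α) = 0 := by
    have : ((‖x‖ₑ ^ (-α) : ℝ≥0∞) : EReal) ≤ 0 := by simpa [expNeg] using h1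
    exact le_antisymm (by exact_mod_cast this) zero_le
  rw [ENNReal.rpow_eq_zero_iff] at h2
  rcases h2 with h2 | h2
  · linarith [h2.2]
  · exact enorm_ne_top h2.1

/-- The integrand is at most `min 1 |x| ^ (-α)`, which is integrable as `α > 2`. -/
lemma shotNoiseConst_ne_top {α : ℝ} (hα : 2 < α) : shotNoiseConst α ≠ ∞ := by
  have hint : Integrable fun x : Plane ↦ 2 ^ α * (1 + ‖x‖) ^ (-α) :=
    (integrable_one_add_norm (by simpa using hα)).const_mul _
  refine ne_top_of_le_ne_top hint.lintegral_lt_top.ne (lintegral_mono fun x ↦ ?_)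
  have hform : (2 : ℝ) ^ α * (1 + ‖x‖) ^ (-α) = ((1 + ‖x‖) / 2) ^ (-α) := by
    rw [Real.div_rpow (by positivity) (by norm_num), Real.rpow_neg two_pos.le, div_inv_eq_mul,
      mul_comm]
  rcases le_or_gt ‖x‖ 1 with hx | hx
  · refine tsub_le_self.trans ?_
    rw [← ENNReal.ofReal_one, hform]
    exact ENNReal.ofReal_le_ofReal
      (Real.one_le_rpow_of_pos_of_le_one_of_nonpos (by positivity) (by linarith) (by linarith))
  · have hx0 : 0 < ‖x‖ := by linarith
    rw [← ofReal_norm, ENNReal.ofReal_rpow_of_pos hx0, expNeg_ofReal (by positivity),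
      ← ENNReal.ofReal_one, ← ENNReal.ofReal_sub _ (by positivity)]
    refine ENNReal.ofReal_le_ofReal ?_
    have h1 := Real.one_sub_le_exp_neg (‖x‖ ^ (-α))
    have h2 : ‖x‖ ^ (-α) ≤ ((1 + ‖x‖) / 2) ^ (-α) :=
      Real.rpow_le_rpow_of_nonpos (by positivity) (by linarith) (by linarith)
    rw [hform]
    linarith

lemma shotNoiseConst_toReal_pos {α : ℝ} (hα : 2 < α) : 0 < (shotNoiseConst α).toReal :=
  ENNReal.toReal_pos (shotNoiseConst_ne_zero (by linarith)) (shotNoiseConst_ne_top hα)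

section LaplaceTransform

variable {Ω : Type*} [MeasurableSpace Ω] {μ : Measure Ω} [IsProbabilityMeasure μ]

/-- The shot noise is positive stable of index `2 / α`. -/
theorem IsHomogeneousPPP.lintegral_expNeg_shotNoise {Φ : Ω → Configuration} {lam : ℝ≥0}
    (hΦ : IsHomogeneousPPP Φ lam μ) {α : ℝ} (hα : 2 < α) {s : ℝ} (hs : 0 < s) :
    ∫⁻ ω, expNeg (ENNReal.ofReal s * shotNoise α (Φ ω)) ∂μ =
      ENNReal.ofReal (Real.exp (-(lam * (shotNoiseConst α).toReal * s ^ (2 / α)))) := by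
  have hmeas : Measurable fun x : Plane ↦ ENNReal.ofReal s * ‖x‖ₑ ^ (-α) :=
    (measurable_enorm_rpow α).const_mul _
  have h := hΦ.lintegral_expNeg hmeas
  simp only [lintegral_const_mul _ (measurable_enorm_rpow α), ← shotNoise_eq_lintegral] at h
  rw [h, lintegral_one_sub_expNeg_mul (by linarith) hs, ← expNeg_ofReal (by positivity)]
  congr 1
  rw [mul_right_comm, ENNReal.ofReal_mul (by positivity), ENNReal.ofReal_mul (by positivity),
    ENNReal.ofReal_toReal (shotNoiseConst_ne_top hα), ENNReal.ofReal_coe_nnreal, mul_assoc]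

/-- The limits of the Laplace transform at `0` and at `∞` are the probabilities that `S` is finite
and that `S` vanishes. -/
lemma ae_mem_Ioo_of_laplace {S : Ω → ℝ≥0∞} (hS : Measurable S) {k δ : ℝ} (hk : 0 < k) (hδ : 0 < δ)
    (hL : ∀ s : ℝ, 0 < s → ∫⁻ ω, expNeg (ENNReal.ofReal s * S ω) ∂μ =
      ENNReal.ofReal (Real.exp (-(k * s ^ δ)))) :
    ∀ᵐ ω ∂μ, S ω ∈ Set.Ioo 0 ∞ := by
  have hfin : ∀ᵐ ω ∂μ, S ω ≠ ∞ := by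
    have hs : MeasurableSet {ω | S ω ≠ ∞} := (hS (measurableSet_singleton ∞)).compl
    have hu : Tendsto (fun n : ℕ ↦ 1 / ((n : ℝ) + 1)) atTop (𝓝 0) :=
      tendsto_one_div_add_atTop_nhds_zero_nat
    have h1 := tendsto_lintegral_expNeg (μ := μ)
      (F := fun n ω ↦ ENNReal.ofReal (1 / ((n : ℝ) + 1)) * S ω)
      (f := fun ω ↦ if S ω = ∞ then ∞ else 0) (fun n ↦ hS.const_mul _) fun ω ↦ by
        split_ifs with h
        · refine tendsto_const_nhds.congr fun n ↦ ?_
          rw [h, ENNReal.mul_top (ENNReal.ofReal_pos.mpr Nat.one_div_pos_of_nat).ne']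
        · simpa using ENNReal.Tendsto.mul_const (ENNReal.tendsto_ofReal hu) (Or.inr h)
    have h2 : ∫⁻ ω, expNeg (if S ω = ∞ then ∞ else 0) ∂μ = μ {ω | S ω ≠ ∞} := by
      rw [← lintegral_indicator_one hs]
      refine lintegral_congr fun ω ↦ ?_
      by_cases h : S ω = ∞ <;> simp [h]
    have h3 : Tendsto (fun n : ℕ ↦ ENNReal.ofReal (Real.exp (-(k * (1 / ((n : ℝ) + 1)) ^ δ))))
        atTop (𝓝 1) := by
      have h4 := (((hu.rpow_const (Or.inr hδ.le)).const_mul k).neg).rexp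
      simpa [Real.zero_rpow hδ.ne'] using ENNReal.tendsto_ofReal h4
    simp only [hL _ Nat.one_div_pos_of_nat, h2] at h1
    exact (mem_ae_iff_prob_eq_one hs).mpr (tendsto_nhds_unique h1 h3)
  have hpos : ∀ᵐ ω ∂μ, S ω ≠ 0 := by
    have hs : MeasurableSet {ω | S ω = 0} := hS (measurableSet_singleton 0)
    have hu : Tendsto (fun n : ℕ ↦ (n : ℝ) + 1) atTop atTop :=
      tendsto_atTop_add_const_right _ _ tendsto_natCast_atTop_atTop
    have h1 := tendsto_lintegral_expNeg (μ := μ)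
      (F := fun n ω ↦ ENNReal.ofReal ((n : ℝ) + 1) * S ω)
      (f := fun ω ↦ if S ω = 0 then 0 else ∞) (fun n ↦ hS.const_mul _) fun ω ↦ by
        split_ifs with h
        · simp [h]
        · have := ENNReal.Tendsto.mul_const (b := S ω) (ENNReal.tendsto_ofReal_nhds_top.2 hu)
            (Or.inl ENNReal.top_ne_zero)
          rwa [ENNReal.top_mul h] at this
    have h2 : ∫⁻ ω, expNeg (if S ω = 0 then 0 else ∞) ∂μ = μ {ω | S ω = 0} := by
      rw [← lintegral_indicator_one hs]
      refine lintegral_congr fun ω ↦ ?_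
      by_cases h : S ω = 0 <;> simp [h]
    have h3 : Tendsto (fun n : ℕ ↦ ENNReal.ofReal (Real.exp (-(k * ((n : ℝ) + 1) ^ δ))))
        atTop (𝓝 0) := by
      have h4 : Tendsto (fun n : ℕ ↦ k * ((n : ℝ) + 1) ^ δ) atTop atTop :=
        ((tendsto_rpow_atTop hδ).comp hu).const_mul_atTop hk
      simpa using ENNReal.tendsto_ofReal (Real.tendsto_exp_neg_atTop_nhds_zero.comp h4)
    simp only [hL _ (Nat.cast_add_one_pos _), h2] at h1
    exact measure_eq_zero_iff_ae_notMem.mp (tendsto_nhds_unique h1 h3)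
  filter_upwards [hfin, hpos] with ω h1 h2
  exact ⟨pos_iff_ne_zero.mpr h2, lt_top_iff_ne_top.mpr h1⟩

end LaplaceTransform

/-! ### Characteristic function of a difference of positive stable variables -/

section StableCharFun

variable {Ω : Type*} [MeasurableSpace Ω] {μ : Measure Ω}

lemma integral_exp_neg_of_laplace {S : Ω → ℝ≥0∞} (hS : Measurable S) (hfin : ∀ᵐ ω ∂μ, S ω < ∞)
    {s c : ℝ} (hs : 0 ≤ s)
    (hL : ∫⁻ ω, expNeg (ENNReal.ofReal s * S ω) ∂μ = ENNReal.ofReal (Real.exp c)) :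
    ∫ ω, Real.exp (-(s * (S ω).toReal)) ∂μ = Real.exp c := by
  have hmeas : Measurable fun ω ↦ expNeg (ENNReal.ofReal s * S ω) :=
    measurable_expNeg.comp (hS.const_mul _)
  rw [← ENNReal.toReal_ofReal (Real.exp_nonneg c), ← hL,
    ← integral_toReal hmeas.aemeasurable (ae_of_all _ fun ω ↦ (expNeg_ne_top _).lt_top)]
  refine integral_congr_ae ?_
  filter_upwards [hfin] with ω hω
  rw [toReal_expNeg (ENNReal.mul_ne_top ENNReal.ofReal_ne_top hω.ne), ENNReal.toReal_mul,
    ENNReal.toReal_ofReal hs]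

variable [IsProbabilityMeasure μ] {X : Ω → ℝ} {k δ : ℝ}

/-- The Laplace transform on the open right half-plane, by the identity theorem. -/
lemma integral_cexp_neg_of_re_pos (hX : Measurable X) (hX0 : ∀ ω, 0 ≤ X ω)
    (hL : ∀ s : ℝ, 0 < s → ∫ ω, Real.exp (-(s * X ω)) ∂μ = Real.exp (-(k * s ^ δ)))
    {z : ℂ} (hz : 0 < z.re) :
    ∫ ω, Complex.exp (-(z * X ω)) ∂μ = Complex.exp (-(k * z ^ (δ : ℂ))) := by
  let Y : Ω → ℝ := fun ω ↦ -X ω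
  let U : Set ℂ := {z | 0 < z.re}
  have hset : Set.Ioi (0 : ℝ) ⊆ interior (integrableExpSet Y μ) := by
    refine interior_maximal (fun s hs ↦ ?_) isOpen_Ioi
    refine Integrable.of_bound (C := 1) (by fun_prop) (ae_of_all _ fun ω ↦ ?_)
    rw [Real.norm_eq_abs, Real.abs_exp, Real.exp_le_one_iff, mul_neg, neg_nonpos]
    exact mul_nonneg (le_of_lt hs) (hX0 ω)
  have hf : AnalyticOnNhd ℂ (complexMGF Y μ) U :=
    analyticOnNhd_complexMGF.mono fun z hz ↦ hset hz
  have hg : AnalyticOnNhd ℂ (fun z : ℂ ↦ Complex.exp (-(k * z ^ (δ : ℂ)))) U := fun z hz ↦ by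
    have : z ∈ Complex.slitPlane := Or.inl hz
    have h1 : AnalyticAt ℂ (fun z : ℂ ↦ z ^ (δ : ℂ)) z := analyticAt_id.cpow analyticAt_const this
    exact (analyticAt_const.mul h1).neg.cexp
  have heq : Set.EqOn (complexMGF Y μ) (fun z : ℂ ↦ Complex.exp (-(k * z ^ (δ : ℂ)))) U := by
    refine hf.eqOn_of_preconnected_of_frequently_eq hg
      (convex_halfSpace_re_gt 0).isPreconnected (z₀ := 1) (by simp [U]) ?_
    have hu : Tendsto (fun n : ℕ ↦ ((1 + 1 / ((n : ℝ) + 1) : ℝ) : ℂ)) atTop (𝓝[≠] 1) := by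
      refine tendsto_nhdsWithin_iff.mpr ⟨?_, Eventually.of_forall fun n ↦ ?_⟩
      · have := (tendsto_one_div_add_atTop_nhds_zero_nat (𝕜 := ℝ)).const_add 1
        rw [add_zero] at this
        exact (Complex.continuous_ofReal.tendsto' 1 1 Complex.ofReal_one).comp this
      · have : (0 : ℝ) < 1 / ((n : ℝ) + 1) := Nat.one_div_pos_of_nat
        intro h
        have h' := Complex.ofReal_eq_one.mp (Set.mem_singleton_iff.mp h)
        linarith
    refine hu.frequently (Frequently.of_forall fun n ↦ ?_)
    have hs : (0 : ℝ) < 1 + 1 / ((n : ℝ) + 1) := by positivity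
    rw [complexMGF_ofReal, mgf, ← Complex.ofReal_cpow hs.le]
    have := hL _ hs
    simp only [Y, mul_neg]
    rw [this]
    push_cast
    rfl
  have := heq hz
  simpa [complexMGF, Y] using this

/-- The Laplace transform on the imaginary axis, by continuity from the right half-plane. -/
lemma integral_cexp_neg_mul_I (hX : Measurable X) (hX0 : ∀ ω, 0 ≤ X ω)
    (hL : ∀ s : ℝ, 0 < s → ∫ ω, Real.exp (-(s * X ω)) ∂μ = Real.exp (-(k * s ^ δ)))
    {t : ℝ} (ht : 0 < t) :
    ∫ ω, Complex.exp (-((t * X ω : ℝ) * Complex.I)) ∂μ =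
      Complex.exp (-((k * t ^ δ : ℝ) * Complex.exp ((Real.pi / 2 * δ : ℝ) * Complex.I))) := by
  let z (n : ℕ) : ℂ := (1 / ((n : ℝ) + 1) : ℝ) + t * Complex.I
  have hz (n : ℕ) : 0 < (z n).re := by
    have : (0 : ℝ) < 1 / ((n : ℝ) + 1) := Nat.one_div_pos_of_nat
    rw [Complex.add_re, Complex.ofReal_re, Complex.re_ofReal_mul, Complex.I_re, mul_zero, add_zero]
    exact this
  have hzlim : Tendsto z atTop (𝓝 (t * Complex.I)) := by
    have := (Complex.continuous_ofReal.tendsto _).comp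
      (tendsto_one_div_add_atTop_nhds_zero_nat (𝕜 := ℝ))
    simpa [z] using this.add_const ((t : ℂ) * Complex.I)
  have h1 : Tendsto (fun n ↦ ∫ ω, Complex.exp (-(z n * X ω)) ∂μ) atTop
      (𝓝 (∫ ω, Complex.exp (-((t : ℂ) * Complex.I * X ω)) ∂μ)) := by
    refine tendsto_integral_of_dominated_convergence (fun _ ↦ 1) (fun n ↦ by fun_prop)
      (integrable_const _) (fun n ↦ ae_of_all _ fun ω ↦ ?_) (ae_of_all _ fun ω ↦ ?_)
    · rw [Complex.norm_exp, Real.exp_le_one_iff, Complex.neg_re, Complex.re_mul_ofReal,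
        neg_nonpos]
      exact mul_nonneg (hz n).le (hX0 ω)
    · exact (hzlim.mul_const _).neg.cexp
  have h2 : Tendsto (fun n ↦ Complex.exp (-(k * z n ^ (δ : ℂ)))) atTop
      (𝓝 (Complex.exp (-(k * ((t : ℂ) * Complex.I) ^ (δ : ℂ))))) := by
    have hslit : (t : ℂ) * Complex.I ∈ Complex.slitPlane := Or.inr (by simpa using ht.ne')
    exact ((hzlim.cpow tendsto_const_nhds hslit).const_mul _).neg.cexp
  have h3 := tendsto_nhds_unique h1
    (h2.congr fun n ↦ (integral_cexp_neg_of_re_pos hX hX0 hL (hz n)).symm)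
  have hpow : ((t : ℂ) * Complex.I) ^ (δ : ℂ) =
      (t ^ δ : ℝ) * Complex.exp ((Real.pi / 2 * δ : ℝ) * Complex.I) := by
    have ht' : (t : ℂ) ≠ 0 := by exact_mod_cast ht.ne'
    rw [Complex.cpow_def_of_ne_zero (mul_ne_zero ht' Complex.I_ne_zero),
      Complex.log_ofReal_mul ht Complex.I_ne_zero, Complex.log_I, add_mul, Complex.exp_add,
      Complex.ofReal_cpow ht.le, Complex.cpow_def_of_ne_zero ht', Complex.ofReal_log ht.le]
    congr 2
    push_cast
    ring
  have harg (ω : Ω) : -((t * X ω : ℝ) * Complex.I) = -((t : ℂ) * Complex.I * X ω) := by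
    push_cast
    ring
  rw [hpow, ← mul_assoc, ← Complex.ofReal_mul] at h3
  simpa only [harg] using h3

variable {Y : Ω → ℝ} {a b : ℝ}

/-- The difference of independent positive stable variables is stable, with characteristic
function `exp (-A t ^ δ + i B t ^ δ)` for `t > 0`. -/
lemma integral_cexp_sub (hX : Measurable X) (hX0 : ∀ ω, 0 ≤ X ω)
    (hY : Measurable Y) (hY0 : ∀ ω, 0 ≤ Y ω) (hXY : IndepFun X Y μ)
    (hLX : ∀ s : ℝ, 0 < s → ∫ ω, Real.exp (-(s * X ω)) ∂μ = Real.exp (-(a * s ^ δ)))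
    (hLY : ∀ s : ℝ, 0 < s → ∫ ω, Real.exp (-(s * Y ω)) ∂μ = Real.exp (-(b * s ^ δ)))
    {t : ℝ} (ht : 0 < t) :
    ∫ ω, Complex.exp ((t * (X ω - Y ω) : ℝ) * Complex.I) ∂μ =
      Complex.exp ((-((a + b) * Real.cos (Real.pi / 2 * δ) * t ^ δ) : ℝ) +
        ((a - b) * Real.sin (Real.pi / 2 * δ) * t ^ δ : ℝ) * Complex.I) := by
  have hXt : ∫ ω, Complex.exp ((t * X ω : ℝ) * Complex.I) ∂μ =
      Complex.exp (-((a * t ^ δ : ℝ) *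
        Complex.exp (-((Real.pi / 2 * δ : ℝ) * Complex.I)))) := by
    have h := congrArg (starRingEnd ℂ) (integral_cexp_neg_mul_I hX hX0 hLX ht)
    rw [← integral_conj] at h
    simpa only [← Complex.exp_conj, map_neg, map_mul, Complex.conj_ofReal, Complex.conj_I,
      mul_neg, neg_neg] using h
  have hYt := integral_cexp_neg_mul_I hY hY0 hLY ht
  have hind : IndepFun (fun ω ↦ Complex.exp ((t * X ω : ℝ) * Complex.I))
      (fun ω ↦ Complex.exp (-((t * Y ω : ℝ) * Complex.I))) μ :=
    hXY.comp (φ := fun x : ℝ ↦ Complex.exp ((t * x : ℝ) * Complex.I))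
      (ψ := fun x : ℝ ↦ Complex.exp (-((t * x : ℝ) * Complex.I)))
      (by fun_prop) (by fun_prop)
  have hprod := hind.integral_fun_mul_eq_mul_integral (by fun_prop) (by fun_prop)
  rw [hXt, hYt] at hprod
  have hsplit (ω : Ω) : Complex.exp ((t * (X ω - Y ω) : ℝ) * Complex.I) =
      Complex.exp ((t * X ω : ℝ) * Complex.I) * Complex.exp (-((t * Y ω : ℝ) * Complex.I)) := by
    rw [← Complex.exp_add]
    congr 1
    push_cast
    ring
  simp only [hsplit]
  rw [hprod, ← Complex.exp_add, ← neg_mul (_ : ℂ) Complex.I, Complex.exp_mul_I,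
    Complex.exp_mul_I, Complex.cos_neg, Complex.sin_neg]
  congr 1
  push_cast
  ring

lemma integral_cos_sub_eq_and_integral_sin_sub_eq (hX : Measurable X) (hX0 : ∀ ω, 0 ≤ X ω)
    (hY : Measurable Y) (hY0 : ∀ ω, 0 ≤ Y ω) (hXY : IndepFun X Y μ)
    (hLX : ∀ s : ℝ, 0 < s → ∫ ω, Real.exp (-(s * X ω)) ∂μ = Real.exp (-(a * s ^ δ)))
    (hLY : ∀ s : ℝ, 0 < s → ∫ ω, Real.exp (-(s * Y ω)) ∂μ = Real.exp (-(b * s ^ δ)))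
    {t : ℝ} (ht : 0 < t) :
    ∫ ω, Real.cos (t * (X ω - Y ω)) ∂μ =
        Real.exp (-((a + b) * Real.cos (Real.pi / 2 * δ) * t ^ δ)) *
          Real.cos ((a - b) * Real.sin (Real.pi / 2 * δ) * t ^ δ) ∧
      ∫ ω, Real.sin (t * (X ω - Y ω)) ∂μ =
        Real.exp (-((a + b) * Real.cos (Real.pi / 2 * δ) * t ^ δ)) *
          Real.sin ((a - b) * Real.sin (Real.pi / 2 * δ) * t ^ δ) := by
  have h := integral_cexp_sub hX hX0 hY hY0 hXY hLX hLY ht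
  have hint : Integrable (fun ω ↦ Complex.exp ((t * (X ω - Y ω) : ℝ) * Complex.I)) μ :=
    Integrable.of_bound (C := 1) (by fun_prop)
      (ae_of_all _ fun ω ↦ (Complex.norm_exp_ofReal_mul_I _).le)
  rw [Complex.exp_add, ← Complex.ofReal_exp] at h
  constructor
  · have hre := congrArg Complex.re h
    rw [Complex.re_ofReal_mul, Complex.exp_ofReal_mul_I_re] at hre
    rw [← hre, ← RCLike.re_eq_complex_re, ← integral_re hint]
    simp only [RCLike.re_eq_complex_re, Complex.exp_ofReal_mul_I_re]
  · have him := congrArg Complex.im h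
    rw [Complex.im_ofReal_mul, Complex.exp_ofReal_mul_I_im] at him
    rw [← him, ← RCLike.im_eq_complex_im, ← integral_im hint]
    simp only [RCLike.im_eq_complex_im, Complex.exp_ofReal_mul_I_im]

end StableCharFun

/-! ### Laplace transforms of the cosine and of the cardinal sine -/

section LaplaceSine

open Set Real

lemma integrableOn_exp_neg_mul {p : ℝ} (hp : 0 < p) :
    IntegrableOn (fun t : ℝ ↦ exp (-(p * t))) (Ioi 0) := by
  simpa only [neg_mul] using integrableOn_exp_mul_Ioi (neg_lt_zero.mpr hp) 0

lemma integral_exp_neg_mul_cos {p : ℝ} (hp : 0 < p) (z : ℝ) :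
    ∫ t in Ioi (0 : ℝ), exp (-(p * t)) * cos (z * t) = p / (p ^ 2 + z ^ 2) := by
  have hre : (-p + z * Complex.I : ℂ).re < 0 := by simpa using hp
  have h := congrArg Complex.re (integral_exp_mul_complex_Ioi hre 0)
  have hint := integrableOn_exp_mul_complex_Ioi hre 0
  rw [← RCLike.re_eq_complex_re, ← integral_re hint] at h
  have hexp (t : ℝ) : RCLike.re (Complex.exp ((-p + z * Complex.I) * t)) =
      exp (-(p * t)) * cos (z * t) := by
    rw [RCLike.re_eq_complex_re, Complex.exp_re]
    simp
  simp only [hexp] at h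
  rw [h, RCLike.re_eq_complex_re]
  simp [Complex.div_re, Complex.normSq_apply]
  ring

lemma abs_sin_mul_div_le (z t : ℝ) : |sin (z * t) / t| ≤ |z| := by
  rw [abs_div]
  refine div_le_of_le_mul₀ (abs_nonneg _) (abs_nonneg _) ?_
  rw [← abs_mul]
  exact abs_sin_le_abs

lemma integrableOn_exp_neg_mul_sinc {p : ℝ} (hp : 0 < p) (z : ℝ) :
    IntegrableOn (fun t : ℝ ↦ exp (-(p * t)) * (sin (z * t) / t)) (Ioi 0) := by
  refine ((integrableOn_exp_neg_mul hp).mul_const |z|).mono' (by fun_prop)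
    (ae_of_all _ fun t ↦ ?_)
  rw [norm_mul, norm_eq_abs, norm_eq_abs, abs_exp]
  exact mul_le_mul_of_nonneg_left (abs_sin_mul_div_le z t) (exp_nonneg _)

/-- Both sides vanish at `z = 0` and have the same derivative in `z`. -/
lemma integral_exp_neg_mul_sinc {p : ℝ} (hp : 0 < p) (z : ℝ) :
    ∫ t in Ioi (0 : ℝ), exp (-(p * t)) * (sin (z * t) / t) = arctan (z / p) := by
  let F (z t : ℝ) : ℝ := exp (-(p * t)) * (sin (z * t) / t)
  have hd (z : ℝ) : HasDerivAt (fun z ↦ ∫ t in Ioi (0 : ℝ), F z t) (p / (p ^ 2 + z ^ 2)) z := by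
    have h := hasDerivAt_integral_of_dominated_loc_of_deriv_le
      (μ := volume.restrict (Ioi (0 : ℝ))) (F := F)
      (F' := fun z t ↦ exp (-(p * t)) * cos (z * t)) (x₀ := z) (s := univ)
      (bound := fun t ↦ exp (-(p * t))) univ_mem
      (Eventually.of_forall fun z ↦ (integrableOn_exp_neg_mul_sinc hp z).aestronglyMeasurable)
      (integrableOn_exp_neg_mul_sinc hp z) (by fun_prop)
      (ae_of_all _ fun t z _ ↦ ?_) (integrableOn_exp_neg_mul hp)
      ((ae_restrict_iff' measurableSet_Ioi).mpr (ae_of_all _ fun t ht z _ ↦ ?_))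
    · rw [integral_exp_neg_mul_cos hp] at h
      exact h.2
    · rw [norm_mul, norm_eq_abs, norm_eq_abs, abs_exp]
      exact mul_le_of_le_one_right (exp_nonneg _) (abs_cos_le_one _)
    · have ht' : t ≠ 0 := (mem_Ioi.mp ht).ne'
      have h1 : HasDerivAt (fun z ↦ sin (z * t)) (cos (z * t) * t) z := by
        simpa using ((hasDerivAt_id z).mul_const t).sin
      have h2 := (h1.div_const t).const_mul (exp (-(p * t)))
      rwa [mul_div_cancel_right₀ _ ht'] at h2
  have ha (z : ℝ) : HasDerivAt (fun z ↦ arctan (z / p)) (p / (p ^ 2 + z ^ 2)) z := by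
    have h := ((hasDerivAt_id z).div_const p).arctan
    convert h using 1
    simp only [id]
    field_simp
    simp
  have hconst := is_const_of_deriv_eq_zero
    (f := fun z ↦ (∫ t in Ioi (0 : ℝ), F z t) - arctan (z / p))
    (fun z ↦ ((hd z).sub (ha z)).differentiableAt)
    (fun z ↦ by rw [((hd z).fun_sub (ha z)).deriv, sub_self]) z 0
  have h0 : ∫ t in Ioi (0 : ℝ), F 0 t = 0 := by simp [F]
  simp only [h0, zero_div, arctan_zero, sub_zero] at hconst
  exact sub_eq_zero.mp hconst

lemma integral_exp_neg_mul_rpow_mul_sin_div {A δ : ℝ} (hA : 0 < A) (hδ : 0 < δ) (B : ℝ) :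
    ∫ t in Ioi (0 : ℝ), exp (-(A * t ^ δ)) * sin (B * t ^ δ) / t = arctan (B / A) / δ := by
  have h := integral_comp_rpow_Ioi_of_pos (g := fun u ↦ exp (-(A * u)) * (sin (B * u) / u)) hδ
  rw [integral_exp_neg_mul_sinc hA] at h
  rw [← h, eq_div_iff hδ.ne', ← integral_mul_const]
  refine setIntegral_congr_fun measurableSet_Ioi fun t ht ↦ ?_
  have ht' : 0 < t := ht
  have hpow : 0 < t ^ δ := rpow_pos_of_pos ht' δ
  simp only [smul_eq_mul]
  rw [rpow_sub_one ht'.ne']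
  field_simp

lemma integrableOn_exp_neg_mul_rpow {A δ : ℝ} (hA : 0 < A) (hδ : 0 < δ) :
    IntegrableOn (fun t : ℝ ↦ exp (-(A * t ^ δ))) (Ioi 0) := by
  simpa using integrableOn_rpow_mul_exp_neg_mul_rpow (s := 0) (by norm_num) hδ hA

lemma integrableOn_exp_neg_mul_rpow_mul_sin_div {A δ : ℝ} (hA : 0 < A) (hδ : 0 < δ) (B : ℝ) :
    IntegrableOn (fun t : ℝ ↦ exp (-(A * t ^ δ)) * sin (B * t ^ δ) / t) (Ioi 0) := by
  have h := integrableOn_rpow_mul_exp_neg_mul_rpow (s := δ - 1) (by linarith) hδ hA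
  refine (h.const_mul |B|).mono' (Measurable.aestronglyMeasurable (by fun_prop))
    ((ae_restrict_iff' measurableSet_Ioi).mpr (ae_of_all _ fun t ht ↦ ?_))
  have ht' : 0 < t := ht
  have hpow : 0 < t ^ δ := rpow_pos_of_pos ht' δ
  rw [norm_eq_abs, abs_div, abs_mul, abs_exp, abs_of_pos ht', rpow_sub_one ht'.ne', neg_mul]
  have h1 : |sin (B * t ^ δ)| ≤ |B| * t ^ δ := by
    refine abs_sin_le_abs.trans ?_
    rw [abs_mul, abs_of_pos hpow]
  calc exp (-(A * t ^ δ)) * |sin (B * t ^ δ)| / t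
      ≤ exp (-(A * t ^ δ)) * (|B| * t ^ δ) / t := by gcongr
    _ = _ := by ring

end LaplaceSine

/-! ### The Gil-Pelaez inversion formula at the origin -/

section GilPelaez

open Set

variable {Ω : Type*} [MeasurableSpace Ω] {μ : Measure Ω} [IsProbabilityMeasure μ] {Z : Ω → ℝ}

/-- Integrability of the real part of the characteristic function excludes an atom at `0`: for every `p > 0`, the
probability of `Z = 0` is at most `E[p² / (p² + Z²)] = p ∫ e^{-pt} E[cos (t Z)] dt`. -/
lemma measure_eq_zero_of_integrableOn_cos (hZ : Measurable Z)
    (hcos : IntegrableOn (fun t ↦ ∫ ω, Real.cos (t * Z ω) ∂μ) (Ioi 0)) :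
    μ {ω | Z ω = 0} = 0 := by
  let K := ∫ t in Ioi (0 : ℝ), |∫ ω, Real.cos (t * Z ω) ∂μ|
  have hset : MeasurableSet {ω | Z ω = 0} := hZ (measurableSet_singleton 0)
  have hbound (p : ℝ) (hp : 0 < p) : μ.real {ω | Z ω = 0} ≤ p * K := by
    have hprod : Integrable (Function.uncurry fun ω t ↦ Real.exp (-(p * t)) * Real.cos (Z ω * t))
        (μ.prod (volume.restrict (Ioi 0))) := by
      have h1 := (integrableOn_exp_neg_mul hp).comp_snd μ
      refine h1.mono' (by fun_prop) (ae_of_all _ fun x ↦ ?_)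
      simp only [Function.uncurry]
      rw [norm_mul, Real.norm_eq_abs, Real.norm_eq_abs, Real.abs_exp]
      exact mul_le_of_le_one_right (Real.exp_nonneg _) (Real.abs_cos_le_one _)
    have hswap := integral_integral_swap hprod
    simp only [integral_exp_neg_mul_cos hp, integral_const_mul] at hswap
    have hint : Integrable (fun ω ↦ p / (p ^ 2 + Z ω ^ 2)) μ := by
      have := hprod.integral_prod_left
      simpa only [Function.uncurry, integral_exp_neg_mul_cos hp] using this
    have hle1 : μ.real {ω | Z ω = 0} ≤ ∫ ω, p * (p / (p ^ 2 + Z ω ^ 2)) ∂μ := by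
      rw [← integral_indicator_one hset]
      refine integral_mono ((integrable_const 1).indicator hset) (hint.const_mul p) fun ω ↦ ?_
      by_cases h : Z ω = 0
      · rw [indicator_of_mem (by simpa using h), h, Pi.one_apply]
        apply le_of_eq
        field_simp
        simp
      · rw [indicator_of_notMem (by simpa using h)]
        positivity
    refine hle1.trans ?_
    rw [integral_const_mul, hswap]
    refine mul_le_mul_of_nonneg_left ?_ hp.le
    refine (le_abs_self _).trans ((abs_integral_le_integral_abs).trans ?_)
    refine integral_mono_of_nonneg (ae_of_all _ fun t ↦ abs_nonneg _) hcos.abs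
      ((ae_restrict_iff' measurableSet_Ioi).mpr (ae_of_all _ fun t ht ↦ ?_))
    simp only [mul_comm _ (t : ℝ)]
    rw [abs_mul, Real.abs_exp]
    refine mul_le_of_le_one_left (abs_nonneg _) (Real.exp_le_one_iff.mpr ?_)
    exact neg_nonpos.mpr (mul_nonneg (le_of_lt ht) hp.le)
  have hlim : Tendsto (fun p : ℝ ↦ p * K) (𝓝[>] 0) (𝓝 0) := by
    have : Tendsto (fun p : ℝ ↦ p * K) (𝓝 0) (𝓝 (0 * K)) := tendsto_id.mul_const K
    rw [zero_mul] at this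
    exact this.mono_left nhdsWithin_le_nhds
  have hle : μ.real {ω | Z ω = 0} ≤ 0 :=
    ge_of_tendsto hlim (eventually_nhdsWithin_of_forall hbound)
  exact (measureReal_eq_zero_iff).mp (le_antisymm hle measureReal_nonneg)

/-- **Gil-Pelaez inversion at the origin.** The kernel `e^{-pt} (1 - e^{-qt}) / t` with `q = 1 / p`
is integrable, so Fubini's theorem applies, and it is bounded by `1 / t`, its limit as `p → 0`. Its sine
transform `arctan (z / p) - arctan (z / (p + q))` tends to `π / 2` times the sign of `z`. -/
theorem measureReal_pos_eq_of_integrableOn (hZ : Measurable Z)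
    (hcos : IntegrableOn (fun t ↦ ∫ ω, Real.cos (t * Z ω) ∂μ) (Ioi 0))
    (hsin : IntegrableOn (fun t ↦ (∫ ω, Real.sin (t * Z ω) ∂μ) / t) (Ioi 0)) :
    μ.real {ω | 0 < Z ω} =
      1 / 2 + 1 / Real.pi * ∫ t in Ioi (0 : ℝ), (∫ ω, Real.sin (t * Z ω) ∂μ) / t := by
  have hpos : MeasurableSet {ω | 0 < Z ω} := measurableSet_lt measurable_const hZ
  have hneg : MeasurableSet {ω | Z ω < 0} := measurableSet_lt hZ measurable_const
  let J := ∫ t in Ioi (0 : ℝ), (∫ ω, Real.sin (t * Z ω) ∂μ) / t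
  let p (n : ℕ) : ℝ := 1 / ((n : ℝ) + 1)
  have hp (n : ℕ) : 0 < p n := Nat.one_div_pos_of_nat
  have hplim : Tendsto p atTop (𝓝 0) := tendsto_one_div_add_atTop_nhds_zero_nat
  have hqlim : Tendsto (fun n ↦ (p n)⁻¹) atTop atTop := by
    simp only [p, one_div, inv_inv]
    exact tendsto_atTop_add_const_right _ _ tendsto_natCast_atTop_atTop
  have hr (n : ℕ) : 0 < p n + (p n)⁻¹ := add_pos (hp n) (inv_pos.mpr (hp n))
  let h (n : ℕ) (t : ℝ) : ℝ :=
    (Real.exp (-(p n * t)) - Real.exp (-((p n + (p n)⁻¹) * t))) / t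
  have hh (n : ℕ) {t : ℝ} (ht : 0 < t) : h n t =
      Real.exp (-(p n * t)) * ((1 - Real.exp (-((p n)⁻¹ * t))) / t) := by
    simp only [h]
    rw [add_mul, neg_add, Real.exp_add]
    ring
  have hh0 (n : ℕ) {t : ℝ} (ht : 0 < t) : 0 ≤ h n t := by
    rw [hh n ht]
    have : Real.exp (-((p n)⁻¹ * t)) ≤ 1 :=
      Real.exp_le_one_iff.mpr (neg_nonpos.mpr (mul_nonneg (inv_pos.mpr (hp n)).le ht.le))
    exact mul_nonneg (Real.exp_nonneg _) (div_nonneg (by linarith) ht.le)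
  have hh1 (n : ℕ) {t : ℝ} (ht : 0 < t) : h n t ≤ 1 / t := by
    have h1 : Real.exp (-(p n * t)) ≤ 1 :=
      Real.exp_le_one_iff.mpr (neg_nonpos.mpr (mul_nonneg (hp n).le ht.le))
    have h2 := Real.exp_nonneg (-((p n + (p n)⁻¹) * t))
    exact div_le_div_of_nonneg_right (by linarith) ht.le
  have hh2 (n : ℕ) {t : ℝ} (ht : 0 < t) : h n t ≤ Real.exp (-(p n * t)) * (p n)⁻¹ := by
    rw [hh n ht]
    refine mul_le_mul_of_nonneg_left ?_ (Real.exp_nonneg _)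
    rw [div_le_iff₀ ht]
    linarith [Real.one_sub_le_exp_neg ((p n)⁻¹ * t)]
  have hhlim {t : ℝ} (ht : 0 < t) : Tendsto (fun n ↦ h n t) atTop (𝓝 (1 / t)) := by
    have h1 : Tendsto (fun n ↦ Real.exp (-(p n * t))) atTop (𝓝 1) := by
      simpa using (hplim.mul_const t).neg.rexp
    have h2 : Tendsto (fun n ↦ Real.exp (-((p n + (p n)⁻¹) * t))) atTop (𝓝 0) := by
      have h3 : Tendsto (fun n ↦ p n + (p n)⁻¹) atTop atTop := hplim.add_atTop hqlim
      exact Real.tendsto_exp_neg_atTop_nhds_zero.comp (h3.atTop_mul_const ht)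
    simpa using (h1.sub h2).div_const t
  have hhmeas (n : ℕ) : Measurable (h n) := by fun_prop
  -- Fubini for the product of the kernel and `sin (t * Z)`
  have hfubini (n : ℕ) :
      ∫ ω, (Real.arctan (Z ω / p n) - Real.arctan (Z ω / (p n + (p n)⁻¹))) ∂μ =
        ∫ t in Ioi (0 : ℝ), h n t * ∫ ω, Real.sin (t * Z ω) ∂μ := by
    have hinner (z : ℝ) : ∫ t in Ioi (0 : ℝ), h n t * Real.sin (t * z) =
        Real.arctan (z / p n) - Real.arctan (z / (p n + (p n)⁻¹)) := by
      rw [← integral_exp_neg_mul_sinc (hp n), ← integral_exp_neg_mul_sinc (hr n),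
        ← integral_sub (integrableOn_exp_neg_mul_sinc (hp n) z)
          (integrableOn_exp_neg_mul_sinc (hr n) z)]
      refine integral_congr_ae (ae_of_all _ fun t ↦ ?_)
      simp only [h, mul_comm t z]
      ring
    have hprod : Integrable (Function.uncurry fun ω t ↦ h n t * Real.sin (t * Z ω))
        (μ.prod (volume.restrict (Ioi 0))) := by
      have h1 : IntegrableOn (h n) (Ioi 0) := by
        refine ((integrableOn_exp_neg_mul (hp n)).mul_const (p n)⁻¹).mono'
          (hhmeas n).aestronglyMeasurable
          ((ae_restrict_iff' measurableSet_Ioi).mpr (ae_of_all _ fun t ht ↦ ?_))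
        rw [Real.norm_eq_abs, abs_of_nonneg (hh0 n ht)]
        exact hh2 n ht
      have hmeas : Measurable (Function.uncurry fun ω t ↦ h n t * Real.sin (t * Z ω)) :=
        ((hhmeas n).comp measurable_snd).mul
          (Real.measurable_sin.comp (measurable_snd.mul (hZ.comp measurable_fst)))
      refine (h1.norm.comp_snd μ).mono' hmeas.aestronglyMeasurable (ae_of_all _ fun x ↦ ?_)
      simp only [Function.uncurry]
      rw [norm_mul]
      exact mul_le_of_le_one_right (norm_nonneg _) (Real.abs_sin_le_one _)
    have hswap := integral_integral_swap hprod
    simpa only [hinner, integral_const_mul] using hswap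
  have hright : Tendsto (fun n ↦ ∫ t in Ioi (0 : ℝ), h n t * ∫ ω, Real.sin (t * Z ω) ∂μ) atTop
      (𝓝 J) := by
    have hsmeas : AEStronglyMeasurable (fun t ↦ ∫ ω, Real.sin (t * Z ω) ∂μ)
        (volume.restrict (Ioi 0)) := by
      have hm : Measurable (Function.uncurry fun (t : ℝ) ω ↦ Real.sin (t * Z ω)) :=
        Real.measurable_sin.comp (measurable_fst.mul (hZ.comp measurable_snd))
      exact hm.stronglyMeasurable.integral_prod_right.aestronglyMeasurable
    refine tendsto_integral_of_dominated_convergence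
      (fun t ↦ |(∫ ω, Real.sin (t * Z ω) ∂μ) / t|)
      (fun n ↦ (hhmeas n).aestronglyMeasurable.mul hsmeas) hsin.abs
      (fun n ↦ (ae_restrict_iff' measurableSet_Ioi).mpr (ae_of_all _ fun t ht ↦ ?_))
      ((ae_restrict_iff' measurableSet_Ioi).mpr (ae_of_all _ fun t ht ↦ ?_))
    · have ht' : 0 < t := ht
      rw [Real.norm_eq_abs, abs_mul, abs_of_nonneg (hh0 n ht'), abs_div, abs_of_pos ht',
        div_eq_mul_one_div, mul_comm]
      exact mul_le_mul_of_nonneg_left (hh1 n ht') (abs_nonneg _)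
    · have := (hhlim ht).mul_const (∫ ω, Real.sin (t * Z ω) ∂μ)
      rwa [one_div_mul_eq_div] at this
  let sgn (ω : Ω) : ℝ := Real.pi / 2 *
    ({ω | 0 < Z ω}.indicator 1 ω - {ω | Z ω < 0}.indicator 1 ω)
  have hleft : Tendsto (fun n ↦
      ∫ ω, (Real.arctan (Z ω / p n) - Real.arctan (Z ω / (p n + (p n)⁻¹))) ∂μ) atTop
      (𝓝 (∫ ω, sgn ω ∂μ)) := by
    refine tendsto_integral_of_dominated_convergence (fun _ ↦ Real.pi) (fun n ↦ by fun_prop)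
      (integrable_const _) (fun n ↦ ae_of_all _ fun ω ↦ ?_) (ae_of_all _ fun ω ↦ ?_)
    · have h1 := Real.arctan_lt_pi_div_two (Z ω / p n)
      have h2 := Real.neg_pi_div_two_lt_arctan (Z ω / p n)
      have h3 := Real.arctan_lt_pi_div_two (Z ω / (p n + (p n)⁻¹))
      have h4 := Real.neg_pi_div_two_lt_arctan (Z ω / (p n + (p n)⁻¹))
      rw [Real.norm_eq_abs, abs_le]
      constructor <;> linarith
    · have h3 : Tendsto (fun n ↦ p n + (p n)⁻¹) atTop atTop := hplim.add_atTop hqlim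
      have h4 : Tendsto (fun n ↦ Real.arctan (Z ω / (p n + (p n)⁻¹))) atTop (𝓝 0) := by
        have := (Real.continuous_arctan.tendsto 0).comp (h3.const_div_atTop (Z ω))
        rwa [Real.arctan_zero] at this
      have h5 : Tendsto (fun n ↦ Real.arctan (Z ω / p n)) atTop (𝓝 (sgn ω)) := by
        simp only [div_eq_mul_inv]
        rcases lt_trichotomy (Z ω) 0 with hz | hz | hz
        · have : sgn ω = -(Real.pi / 2) := by simp [sgn, hz, hz.le]
          rw [this]
          exact (Real.tendsto_arctan_atBot.mono_right nhdsWithin_le_nhds).comp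
            (hqlim.const_mul_atTop_of_neg hz)
        · have : sgn ω = 0 := by simp [sgn, hz]
          simp [this, hz]
        · have : sgn ω = Real.pi / 2 := by simp [sgn, hz, hz.le]
          rw [this]
          exact (Real.tendsto_arctan_atTop.mono_right nhdsWithin_le_nhds).comp
            (hqlim.const_mul_atTop hz)
      simpa using h5.sub h4
  have hJ : Real.pi / 2 * (μ.real {ω | 0 < Z ω} - μ.real {ω | Z ω < 0}) = J := by
    rw [← tendsto_nhds_unique hleft (hright.congr fun n ↦ (hfubini n).symm), integral_const_mul,
      integral_sub ((integrable_const 1).indicator hpos) ((integrable_const 1).indicator hneg),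
      integral_indicator_one hpos, integral_indicator_one hneg]
  have hsum : μ.real {ω | 0 < Z ω} + μ.real {ω | Z ω < 0} = 1 := by
    have hdisj : Disjoint {ω | 0 < Z ω} {ω | Z ω < 0} :=
      disjoint_left.mpr fun ω (h1 : 0 < Z ω) (h2 : Z ω < 0) ↦ lt_asymm h1 h2
    rw [← measureReal_union hdisj hneg, ← probReal_univ (μ := μ)]
    refine measureReal_congr ?_
    filter_upwards [measure_eq_zero_iff_ae_notMem.mp (measure_eq_zero_of_integrableOn_cos hZ hcos)]
      with ω hω
    exact propext ⟨fun _ ↦ trivial, fun _ ↦ (lt_or_gt_of_ne hω).symm⟩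
  have hpi := Real.pi_pos
  change _ = 1 / 2 + 1 / Real.pi * J
  rw [← hJ, eq_sub_of_add_eq' hsum]
  field_simp
  ring

end GilPelaez

/-! ### The law of the ratio -/

/-- The difference of two independent positive stable variables of index `δ` is strictly stable, and
this is its positivity parameter. -/
theorem measureReal_sub_pos_of_laplace {Ω : Type*} [MeasurableSpace Ω] {μ : Measure Ω}
    [IsProbabilityMeasure μ] {X Y : Ω → ℝ} {a b δ : ℝ} (ha : 0 < a) (hb : 0 < b) (hδ : 0 < δ)
    (hδ1 : δ < 1) (hX : Measurable X) (hX0 : ∀ ω, 0 ≤ X ω)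
    (hY : Measurable Y) (hY0 : ∀ ω, 0 ≤ Y ω) (hXY : IndepFun X Y μ)
    (hLX : ∀ s : ℝ, 0 < s → ∫ ω, Real.exp (-(s * X ω)) ∂μ = Real.exp (-(a * s ^ δ)))
    (hLY : ∀ s : ℝ, 0 < s → ∫ ω, Real.exp (-(s * Y ω)) ∂μ = Real.exp (-(b * s ^ δ))) :
    μ.real {ω | 0 < X ω - Y ω} = 1 / 2 + 1 / (Real.pi * δ) *
      Real.arctan ((a - b) / (a + b) * Real.tan (Real.pi / 2 * δ)) := by
  have hchar := fun t (ht : 0 < t) ↦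
    integral_cos_sub_eq_and_integral_sin_sub_eq hX hX0 hY hY0 hXY hLX hLY ht
  have hpi := Real.pi_pos
  have hcospos : 0 < Real.cos (Real.pi / 2 * δ) :=
    Real.cos_pos_of_mem_Ioo ⟨by nlinarith, by nlinarith⟩
  set A := (a + b) * Real.cos (Real.pi / 2 * δ) with hA
  set B := (a - b) * Real.sin (Real.pi / 2 * δ) with hB
  have hApos : 0 < A := mul_pos (add_pos ha hb) hcospos
  have hcos : IntegrableOn (fun t ↦ ∫ ω, Real.cos (t * (X ω - Y ω)) ∂μ) (Set.Ioi 0) := by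
    refine IntegrableOn.congr_fun ?_ (fun t ht ↦ (hchar t ht).1.symm) measurableSet_Ioi
    refine (integrableOn_exp_neg_mul_rpow hApos hδ).mono'
      (Measurable.aestronglyMeasurable (by fun_prop)) (ae_of_all _ fun t ↦ ?_)
    rw [norm_mul, Real.norm_eq_abs, Real.norm_eq_abs, Real.abs_exp]
    exact mul_le_of_le_one_right (Real.exp_nonneg _) (Real.abs_cos_le_one _)
  have hsin : IntegrableOn (fun t ↦ (∫ ω, Real.sin (t * (X ω - Y ω)) ∂μ) / t) (Set.Ioi 0) := by
    refine IntegrableOn.congr_fun (integrableOn_exp_neg_mul_rpow_mul_sin_div hApos hδ B)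
      (fun t ht ↦ ?_) measurableSet_Ioi
    simp only [(hchar t ht).2]
  rw [measureReal_pos_eq_of_integrableOn (hX.fun_sub hY) hcos hsin,
    setIntegral_congr_fun measurableSet_Ioi
      (g := fun t ↦ Real.exp (-(A * t ^ δ)) * Real.sin (B * t ^ δ) / t)
      (fun t ht ↦ by simp only [(hchar t ht).2]),
    integral_exp_neg_mul_rpow_mul_sin_div hApos hδ]
  have hBA : B / A = (a - b) / (a + b) * Real.tan (Real.pi / 2 * δ) := by
    rw [hA, hB, Real.tan_eq_sin_div_cos, mul_div_mul_comm]
  rw [hBA]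
  field_simp

theorem proposition2 {Ω : Type*} [MeasurableSpace Ω] (μ : Measure Ω) [IsProbabilityMeasure μ]
    (α : ℝ) (hα : 2 < α) (lam₁ lam₂ : ℝ≥0) (hlam₁ : 0 < lam₁) (hlam₂ : 0 < lam₂)
    (Φ₁ Φ₂ : Ω → Configuration)
    (hΦ₁ : IsHomogeneousPPP Φ₁ lam₁ μ) (hΦ₂ : IsHomogeneousPPP Φ₂ lam₂ μ)
    (hindep : IndepFun Φ₁ Φ₂ μ) :
    (∀ᵐ ω ∂μ, shotNoise α (Φ₁ ω) ∈ Set.Ioo 0 ∞ ∧ shotNoise α (Φ₂ ω) ∈ Set.Ioo 0 ∞) ∧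
    ∀ x : ℝ, 0 ≤ x →
      μ.real {ω | ENNReal.ofReal x < shotNoiseRatio α (Φ₁ ω) (Φ₂ ω)} =
        1 / 2 + α / (2 * Real.pi) *
          Real.arctan ((-1 + 2 / (1 + (lam₂ : ℝ) / (lam₁ : ℝ) * x ^ (2 / α))) *
            Real.tan (Real.pi / α)) := by
  have hα0 : 0 < α := by linarith
  have hδ : 0 < 2 / α := by positivity
  have hδ1 : 2 / α < 1 := (div_lt_one hα0).mpr hα
  have hC := shotNoiseConst_toReal_pos hα
  have hl₁ : (0 : ℝ) < lam₁ := hlam₁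
  have hl₂ : (0 : ℝ) < lam₂ := hlam₂
  set C := (shotNoiseConst α).toReal with hCdef
  have hS₁ : Measurable fun ω ↦ shotNoise α (Φ₁ ω) :=
    (measurable_shotNoise α).comp hΦ₁.measurable
  have hS₂ : Measurable fun ω ↦ shotNoise α (Φ₂ ω) :=
    (measurable_shotNoise α).comp hΦ₂.measurable
  have hae₁ := ae_mem_Ioo_of_laplace hS₁ (mul_pos hl₁ hC) hδ
    fun s hs ↦ hΦ₁.lintegral_expNeg_shotNoise hα hs
  have hae₂ := ae_mem_Ioo_of_laplace hS₂ (mul_pos hl₂ hC) hδ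
    fun s hs ↦ hΦ₂.lintegral_expNeg_shotNoise hα hs
  refine ⟨hae₁.and hae₂, fun x hx ↦ ?_⟩
  have hangle : Real.pi / 2 * (2 / α) = Real.pi / α := by field_simp
  rcases hx.eq_or_lt with rfl | hx
  · -- `R > 0` almost surely, and `arctan (tan (π / α)) = π / α`.
    have hone : μ.real {ω | ENNReal.ofReal 0 < shotNoiseRatio α (Φ₁ ω) (Φ₂ ω)} = 1 := by
      rw [← probReal_univ (μ := μ)]
      refine measureReal_congr ?_
      filter_upwards [hae₁, hae₂] with ω h1 h2
      refine propext ⟨fun _ ↦ trivial, fun _ ↦ ?_⟩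
      change ENNReal.ofReal 0 < _
      rw [ENNReal.ofReal_zero]
      exact ENNReal.div_pos h1.1.ne' h2.2.ne
    have hpi := Real.pi_pos
    have hlt : Real.pi / α < Real.pi / 2 := div_lt_div_of_pos_left hpi two_pos hα
    have hpos : 0 < Real.pi / α := by positivity
    rw [hone, Real.zero_rpow hδ.ne', mul_zero, add_zero, div_one, neg_add_eq_sub,
      show (2 : ℝ) - 1 = 1 by norm_num, one_mul, Real.arctan_tan (by linarith) hlt]
    field_simp
    norm_num
  · have hset : μ.real {ω | ENNReal.ofReal x < shotNoiseRatio α (Φ₁ ω) (Φ₂ ω)} =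
        μ.real {ω | 0 < (shotNoise α (Φ₁ ω)).toReal - x * (shotNoise α (Φ₂ ω)).toReal} := by
      refine measureReal_congr ?_
      filter_upwards [hae₁, hae₂] with ω h1 h2
      refine propext ?_
      change ENNReal.ofReal x < shotNoise α (Φ₁ ω) / shotNoise α (Φ₂ ω) ↔ 0 < _ - _
      rw [ENNReal.lt_div_iff_mul_lt (Or.inl h2.1.ne') (Or.inl h2.2.ne), sub_pos,
        ← ENNReal.toReal_lt_toReal (ENNReal.mul_ne_top ENNReal.ofReal_ne_top h2.2.ne) h1.2.ne,
        ENNReal.toReal_mul, ENNReal.toReal_ofReal hx.le]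
    have hLX (s : ℝ) (hs : 0 < s) :
        ∫ ω, Real.exp (-(s * (shotNoise α (Φ₁ ω)).toReal)) ∂μ =
          Real.exp (-(lam₁ * C * s ^ (2 / α))) :=
      integral_exp_neg_of_laplace hS₁ (hae₁.mono fun ω h ↦ h.2) hs.le
        (hΦ₁.lintegral_expNeg_shotNoise hα hs)
    have hLY (s : ℝ) (hs : 0 < s) :
        ∫ ω, Real.exp (-(s * (x * (shotNoise α (Φ₂ ω)).toReal))) ∂μ =
          Real.exp (-(lam₂ * C * x ^ (2 / α) * s ^ (2 / α))) := by
      have h := integral_exp_neg_of_laplace hS₂ (hae₂.mono fun ω h ↦ h.2) (mul_pos hs hx).le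
        (hΦ₂.lintegral_expNeg_shotNoise hα (mul_pos hs hx))
      simp only [← mul_assoc]
      rw [h, Real.mul_rpow hs.le hx.le]
      congr 2
      ring
    have hind : IndepFun (fun ω ↦ (shotNoise α (Φ₁ ω)).toReal)
        (fun ω ↦ x * (shotNoise α (Φ₂ ω)).toReal) μ :=
      hindep.comp (φ := fun φ ↦ (shotNoise α φ).toReal) (ψ := fun φ ↦ x * (shotNoise α φ).toReal)
        (measurable_shotNoise α).ennreal_toReal
        ((measurable_shotNoise α).ennreal_toReal.const_mul x)
    have hxpow : 0 < x ^ (2 / α) := Real.rpow_pos_of_pos hx _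
    rw [hset, measureReal_sub_pos_of_laplace (mul_pos hl₁ hC)
      (mul_pos (mul_pos hl₂ hC) hxpow) hδ hδ1 hS₁.ennreal_toReal
      (fun ω ↦ ENNReal.toReal_nonneg) (hS₂.ennreal_toReal.const_mul x)
      (fun ω ↦ mul_nonneg hx.le ENNReal.toReal_nonneg) hind hLX hLY, hangle]
    have hcoef : 1 / (Real.pi * (2 / α)) = α / (2 * Real.pi) := by
      field_simp
    have hratio : (lam₁ * C - lam₂ * C * x ^ (2 / α)) / (lam₁ * C + lam₂ * C * x ^ (2 / α)) =
        -1 + 2 / (1 + (lam₂ : ℝ) / lam₁ * x ^ (2 / α)) := by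
      have hd : (lam₁ : ℝ) + lam₂ * x ^ (2 / α) ≠ 0 := by positivity
      have hd' : (lam₁ : ℝ) * C + lam₂ * C * x ^ (2 / α) ≠ 0 := by positivity
      have hd'' : 1 + (lam₂ : ℝ) / lam₁ * x ^ (2 / α) ≠ 0 := by positivity
      field_simp
      ring
    rw [hcoef, hratio]
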